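/- Theorem. Let $M_2$ be the set of $2\times 2$ complex matrices, and let $\nu$ be the Gaussian measure $d\nu(\mathbf H)=\pi^{-4}\exp(-\mathrm{Tr}(\mathbf H^{*}\mathbf H))\,d\mathbf H$ on $M_2$, where $d\mathbf H$ is Lebesgue measure on $M_2\cong\mathbb R^{8}$; that is, the entries of $\mathbf H$ are independent, identically distributed standard complex Gaussian random variables with zero mean and unit variance. Let $\mathbf A$ be a Hermitian $2\times 2$ matrix with eigenvalues $d_1,d_2$ (counted with multiplicity) and let $m\ge 1$ be an integer. Then $\mathrm{Tr}\big((\mathbf H^{*}\mathbf A\mathbf H)^m\big)$ is $\nu$-integrable. If $d_1\neq d_2$, then $$\int_{M_2}\mathrm{Tr}\big((\mathbf H^{*}\mathbf A\mathbf H)^m\big)\,d\nu(\mathbf H)=m!\left((m+1)\frac{d_1^{m+1}-d_2^{m+1}}{d_1-d_2}+\frac{d_1d_2^{m}-d_2d_1^{m}}{d_1-d_2}\right).$$ If $d_1=d_2=d$, then $$\int_{M_2}\mathrm{Tr}\big((\mathbf H^{*}\mathbf A\mathbf H)^m\big)\,d\nu(\mathbf H)=m!\,(m^2+m+2)\,d^{m}.$$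 -/

import Mathlib

open MeasureTheory
open scoped Matrix Nat

/-- The Gaussian measure `dν(H) = π ^ (-n²) exp (-tr (H* H)) dH` on `n × n` complex matrices, where
`dH` is Lebesgue measure on `ℂ ^ (n × n)` (of real dimension `2 n²`). A matrix is written here as the
function of its entries. The trace of `H* H` is a real number; `.re` only serves to view it in
`ℝ`. -/
noncomputable def gaussianMatrixMeasure (n : ℕ) : Measure (Fin n → Fin n → ℂ) :=
  (volume : Measure (Fin n → Fin n → ℂ)).withDensity fun H =>
    ENNReal.ofReal
      ((Real.pi ^ (n ^ 2))⁻¹ * Real.exp (-((Matrix.of H)ᴴ * Matrix.of H).trace.re))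

/-! Write `h_k` for the complete homogeneous polynomial. For a 2 × 2 Hermitian `M`, with `h_k` taken
at its eigenvalues, `Tr M^m = h_m - det M · h_{m-2}` when `m ≥ 2`. After diagonalising `M` by a
unitary, `k! h_k` is the average of `(v* M v)^k` over a Gaussian vector `v`.

Take `M = H* A H`, so that `v* M v = (Hv)* A (Hv)` and `det M = det A · |det H|²`. After Fubini `v`
is fixed, and right unitary invariance of `H` replaces `Hv` by `|v|` times the first column `c` of
`H`. Since `|v|^{2k}` has mean `(k+1)!`, the average of `w(H) h_k` is `(k+1) E[w(H) (c* A c)^k]` for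
every invariant weight `w` (`integral_mul_completeHomogeneous_eigenvalues`). For `w = 1` the
remaining expectation is `k! h_k(d₁, d₂)`. For `w = |det H|²`, averaging over the other column
leaves `|c|²`, which gives `(k+2) k! h_k(d₁, d₂)`. Hence the answer is `m! ((m+1) h_m - d₁ d₂
h_{m-2})` at `d₁, d₂`. -/

/-- The standard complex Gaussian distribution on `ℂ`, with mean zero and unit variance. -/
noncomputable def stdComplexGaussian : Measure ℂ :=
  (volume : Measure ℂ).withDensity fun z =>
    ENNReal.ofReal (Real.pi⁻¹ * Real.exp (-Complex.normSq z))

theorem continuous_stdComplexGaussian_density :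
    Continuous fun z : ℂ => Real.pi⁻¹ * Real.exp (-Complex.normSq z) := by
  have := Complex.continuous_normSq
  fun_prop

theorem integral_stdComplexGaussian (f : ℂ → ℝ) :
    ∫ z, f z ∂stdComplexGaussian =
      ∫ z, (Real.pi⁻¹ * Real.exp (-Complex.normSq z)) * f z := by
  rw [stdComplexGaussian, integral_withDensity_eq_integral_toReal_smul₀]
  · refine integral_congr_ae (.of_forall fun z => ?_)
    simp only [smul_eq_mul]
    rw [ENNReal.toReal_ofReal (by positivity)]
  · exact continuous_stdComplexGaussian_density.measurable.ennreal_ofReal.aemeasurable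
  · exact .of_forall fun _ => ENNReal.ofReal_lt_top

theorem integral_normSq_pow_stdComplexGaussian (k : ℕ) :
    ∫ z, Complex.normSq z ^ k ∂stdComplexGaussian = (k ! : ℝ) := by
  have h := Complex.integral_rpow_mul_exp_neg_rpow (p := 2) (q := 2 * k) (by norm_num)
    (by have : (0 : ℝ) ≤ k := k.cast_nonneg
        linarith)
  rw [show ((2 * k + 2 : ℝ) / 2) = k + 1 by ring, Real.Gamma_nat_eq_factorial] at h
  rw [integral_stdComplexGaussian]
  have h2 : ∀ z : ℂ, Real.pi⁻¹ * Real.exp (-Complex.normSq z) * Complex.normSq z ^ k =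
      Real.pi⁻¹ * (‖z‖ ^ (2 * k : ℝ) * Real.exp (-‖z‖ ^ (2 : ℝ))) := by
    intro z
    rw [show (2 * k : ℝ) = ((2 * k : ℕ) : ℝ) by push_cast; ring, Real.rpow_natCast,
      show (2 : ℝ) = ((2 : ℕ) : ℝ) by norm_num, Real.rpow_natCast, Complex.normSq_eq_norm_sq,
      pow_mul]
    ring
  simp_rw [h2]
  rw [integral_const_mul, h]
  field_simp

theorem integrable_normSq_pow_stdComplexGaussian (k : ℕ) :
    Integrable (fun z => Complex.normSq z ^ k) stdComplexGaussian := by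
  -- A non-integrable function has integral `0` by convention, but this integral is `k! ≠ 0`.
  by_contra h
  have h2 := integral_normSq_pow_stdComplexGaussian k
  rw [integral_undef h] at h2
  exact absurd h2.symm (by positivity)

instance : IsProbabilityMeasure stdComplexGaussian := by
  have h1 := integral_normSq_pow_stdComplexGaussian 0
  simp only [pow_zero, integral_const, smul_eq_mul, mul_one, Nat.factorial_zero, Nat.cast_one] at h1
  refine ⟨?_⟩
  rwa [measureReal_def, ENNReal.toReal_eq_one_iff] at h1

/-! ### Functions with finite moments of every order -/

/-- A function all of whose absolute moments are finite. -/
def HasAllMoments {Ω : Type*} [MeasurableSpace Ω] (f : Ω → ℂ) (μ : Measure Ω) : Prop :=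
  ∀ p : ℕ, MemLp f p μ

namespace HasAllMoments

variable {Ω Ω' : Type*} [MeasurableSpace Ω] [MeasurableSpace Ω'] {μ : Measure Ω} {μ' : Measure Ω'}
  {f g : Ω → ℂ}

theorem integrable (hf : HasAllMoments f μ) : Integrable f μ :=
  memLp_one_iff_integrable.1 (by simpa using hf 1)

theorem const [IsFiniteMeasure μ] (c : ℂ) : HasAllMoments (fun _ => c) μ := fun _ => memLp_const c

theorem add (hf : HasAllMoments f μ) (hg : HasAllMoments g μ) :
    HasAllMoments (fun x => f x + g x) μ := fun p => (hf p).add (hg p)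

theorem sub (hf : HasAllMoments f μ) (hg : HasAllMoments g μ) :
    HasAllMoments (fun x => f x - g x) μ := fun p => (hf p).sub (hg p)

/-- Hölder's inequality with exponents `2p, 2p, p`. -/
theorem mul (hf : HasAllMoments f μ) (hg : HasAllMoments g μ) :
    HasAllMoments (fun x => f x * g x) μ := by
  intro p
  have : ENNReal.HolderTriple ((2 * p : ℕ) : ENNReal) ((2 * p : ℕ) : ENNReal) p := by
    constructor
    push_cast
    rw [ENNReal.mul_inv (by simp) (by simp), ← add_mul, ENNReal.inv_two_add_inv_two, one_mul]
  exact (hg (2 * p)).mul' (hf (2 * p))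

theorem pow [IsFiniteMeasure μ] (hf : HasAllMoments f μ) (k : ℕ) :
    HasAllMoments (fun x => f x ^ k) μ := by
  induction k with
  | zero => simpa using const 1
  | succ k ih => simpa [pow_succ] using ih.mul hf

theorem star (hf : HasAllMoments f μ) : HasAllMoments (fun x => star (f x)) μ := fun p => (hf p).star

theorem comp {f : Ω' → ℂ} (hf : HasAllMoments f μ') {T : Ω → Ω'} (hT : MeasurePreserving T μ μ') :
    HasAllMoments (fun x => f (T x)) μ := fun p => (hf p).comp_measurePreserving hT

end HasAllMoments

theorem hasAllMoments_stdComplexGaussian : HasAllMoments (fun z => z) stdComplexGaussian := by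
  intro p
  have hm : AEStronglyMeasurable (fun z : ℂ => z) stdComplexGaussian := aestronglyMeasurable_id
  have h : MemLp (fun z : ℂ => z) ((2 * p : ℕ) : ENNReal) stdComplexGaussian := by
    rcases Nat.eq_zero_or_pos p with rfl | hp
    · simpa using hm
    rw [← integrable_norm_rpow_iff hm (by exact_mod_cast (by omega : 2 * p ≠ 0))
      (ENNReal.natCast_ne_top _)]
    refine (integrable_normSq_pow_stdComplexGaussian p).congr (.of_forall fun z => ?_)
    simp only [ENNReal.toReal_natCast, Real.rpow_natCast, Complex.normSq_eq_norm_sq, pow_mul]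
  exact h.mono_exponent (by exact_mod_cast (by omega : p ≤ 2 * p))

/-! ### Gaussian vectors and matrices, and their symmetries -/

/-- The distribution of a vector with two independent standard complex Gaussian entries. -/
noncomputable abbrev gaussianVectorMeasure : Measure (Fin 2 → ℂ) :=
  Measure.pi fun _ => stdComplexGaussian

theorem pi_withDensity_finTwo {α : Type*} [MeasurableSpace α] (μ : Measure α) [SigmaFinite μ]
    (f : α → ENNReal) (hf : Measurable f) [SigmaFinite (μ.withDensity f)] :
    Measure.pi (fun _ : Fin 2 => μ.withDensity f) =
      (Measure.pi fun _ : Fin 2 => μ).withDensity fun x => f (x 0) * f (x 1) := by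
  have h1 := measurePreserving_finTwoArrow (μ.withDensity f)
  have h2 := measurePreserving_finTwoArrow μ
  rw [← (MeasurableEquiv.finTwoArrow (α := α)).map_measurableEquiv_injective.eq_iff, h1.map_eq,
    prod_withDensity hf hf, ← h2.map_eq]
  ext s hs
  rw [withDensity_apply _ hs, MeasurableEquiv.map_apply,
    withDensity_apply _ (MeasurableEquiv.measurable _ hs), setLIntegral_map hs (by fun_prop)
      (MeasurableEquiv.measurable _)]
  rfl

theorem gaussianVectorMeasure_eq :
    gaussianVectorMeasure = volume.withDensity fun v =>
      ENNReal.ofReal (Real.pi⁻¹ * Real.exp (-Complex.normSq (v 0))) *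
        ENNReal.ofReal (Real.pi⁻¹ * Real.exp (-Complex.normSq (v 1))) := by
  have : SigmaFinite (volume.withDensity fun z : ℂ =>
    ENNReal.ofReal (Real.pi⁻¹ * Real.exp (-Complex.normSq z))) :=
    inferInstanceAs (SigmaFinite stdComplexGaussian)
  exact pi_withDensity_finTwo volume _
    continuous_stdComplexGaussian_density.measurable.ennreal_ofReal

theorem gaussianMatrixMeasure_two :
    gaussianMatrixMeasure 2 = Measure.pi fun _ : Fin 2 => gaussianVectorMeasure := by
  have hs : SigmaFinite gaussianVectorMeasure := inferInstance
  rw [gaussianVectorMeasure_eq] at hs ⊢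
  have hc := continuous_stdComplexGaussian_density.measurable.ennreal_ofReal
  rw [pi_withDensity_finTwo, gaussianMatrixMeasure]
  · congr 1
    ext H
    rw [← ENNReal.ofReal_mul (by positivity), ← ENNReal.ofReal_mul (by positivity),
      ← ENNReal.ofReal_mul (by positivity)]
    congr 1
    have : ((Matrix.of H)ᴴ * Matrix.of H).trace.re = Complex.normSq (H 0 0) +
        Complex.normSq (H 0 1) + Complex.normSq (H 1 0) + Complex.normSq (H 1 1) := by
      simp [Matrix.trace, Matrix.mul_apply, Fin.sum_univ_two, Complex.normSq_apply]
      ring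
    rw [this, neg_add, neg_add, neg_add, Real.exp_add, Real.exp_add, Real.exp_add]
    ring
  · exact (hc.comp (measurable_pi_apply 0)).mul (hc.comp (measurable_pi_apply 1))

/-- An invertible linear map scales Haar measure by a constant, and the density is invariant, so the
pushforward is a constant multiple of the same measure. Total mass one forces the constant to be
`1`, so `|det T|` need not be computed. -/
theorem measurePreserving_of_linearMap {E : Type*} [NormedAddCommGroup E] [NormedSpace ℝ E]
    [FiniteDimensional ℝ E] [MeasurableSpace E] [BorelSpace E] (μ : Measure E) [μ.IsAddHaarMeasure]
    (ρ : E → ENNReal) (hρ : Measurable ρ) [IsProbabilityMeasure (μ.withDensity ρ)]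
    (T S : E →ₗ[ℝ] E) (hTS : T ∘ₗ S = LinearMap.id) (h : ∀ x, ρ (T x) = ρ x) :
    MeasurePreserving T (μ.withDensity ρ) (μ.withDensity ρ) := by
  have hdet : LinearMap.det T ≠ 0 := by
    intro h0
    have := congrArg LinearMap.det hTS
    rw [LinearMap.det_comp, h0, zero_mul, LinearMap.det_id] at this
    exact zero_ne_one this
  have hT : Measurable T := T.continuous_of_finiteDimensional.measurable
  have hmap := Measure.map_linearMap_addHaar_eq_smul_addHaar μ hdet
  set c := ENNReal.ofReal |(LinearMap.det T)⁻¹|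
  have key : (μ.withDensity ρ).map T = c • μ.withDensity ρ := by
    ext s hs
    rw [Measure.map_apply hT hs, withDensity_apply _ (hT hs), Measure.smul_apply,
      withDensity_apply _ hs, ← lintegral_smul_measure, ← Measure.restrict_smul, ← hmap,
      setLIntegral_map hs hρ hT]
    simp_rw [h]
  have hc : c = 1 := by
    have := congrArg (fun ν : Measure E => ν Set.univ) key
    simpa [Measure.map_apply hT MeasurableSet.univ] using this.symm
  exact ⟨hT, by rw [key, hc, one_smul]⟩

theorem measurePreserving_unitary (U : Matrix (Fin 2) (Fin 2) ℂ) (hU : Uᴴ * U = 1) :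
    MeasurePreserving (fun v : Fin 2 → ℂ => U *ᵥ v) gaussianVectorMeasure
      gaussianVectorMeasure := by
  have hp : IsProbabilityMeasure gaussianVectorMeasure := inferInstance
  rw [gaussianVectorMeasure_eq] at hp ⊢
  have hc := continuous_stdComplexGaussian_density.measurable.ennreal_ofReal
  refine measurePreserving_of_linearMap volume (fun v : Fin 2 → ℂ =>
      ENNReal.ofReal (Real.pi⁻¹ * Real.exp (-Complex.normSq (v 0))) *
        ENNReal.ofReal (Real.pi⁻¹ * Real.exp (-Complex.normSq (v 1))))
    ((hc.comp (measurable_pi_apply 0)).mul (hc.comp (measurable_pi_apply 1)))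
    ((Matrix.toLin' U).restrictScalars ℝ) ((Matrix.toLin' Uᴴ).restrictScalars ℝ) ?_ ?_
  · refine LinearMap.ext fun v => ?_
    simp only [LinearMap.comp_apply, LinearMap.coe_restrictScalars, Matrix.toLin'_apply,
      Matrix.mulVec_mulVec, mul_eq_one_comm.1 hU, Matrix.one_mulVec, LinearMap.id_apply]
  · intro v
    have key : Complex.normSq ((U *ᵥ v) 0) + Complex.normSq ((U *ᵥ v) 1) =
        Complex.normSq (v 0) + Complex.normSq (v 1) := by
      have e : ∀ w : Fin 2 → ℂ, ((Complex.normSq (w 0) + Complex.normSq (w 1) : ℝ) : ℂ) =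
          star w ⬝ᵥ w := by
        intro w
        simp [dotProduct, Fin.sum_univ_two, Complex.normSq_eq_conj_mul_self]
      have : star (U *ᵥ v) ⬝ᵥ (U *ᵥ v) = star v ⬝ᵥ v := by
        rw [Matrix.star_mulVec, ← Matrix.dotProduct_mulVec, Matrix.mulVec_mulVec, hU,
          Matrix.one_mulVec]
      rw [← e, ← e] at this
      exact_mod_cast this
    simp only [LinearMap.coe_restrictScalars, Matrix.toLin'_apply]
    rw [← ENNReal.ofReal_mul (by positivity), ← ENNReal.ofReal_mul (by positivity)]
    congr 1
    have e2 : ∀ a b : ℝ, Real.pi⁻¹ * Real.exp (-a) * (Real.pi⁻¹ * Real.exp (-b)) =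
        Real.pi⁻¹ ^ 2 * Real.exp (-(a + b)) := by
      intro a b
      rw [neg_add, Real.exp_add]
      ring
    rw [e2, e2, key]

instance : IsProbabilityMeasure (gaussianMatrixMeasure 2) := by
  rw [gaussianMatrixMeasure_two]
  infer_instance

/-- The product structure of the measure is by rows; transposition carries it over to columns. -/
theorem measurePreserving_transpose :
    MeasurePreserving (fun (H : Fin 2 → Fin 2 → ℂ) i j => H j i) (gaussianMatrixMeasure 2)
      (gaussianMatrixMeasure 2) := by
  have hp : IsProbabilityMeasure (gaussianMatrixMeasure 2) := inferInstance
  rw [gaussianMatrixMeasure] at hp ⊢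
  let T : (Fin 2 → Fin 2 → ℂ) →ₗ[ℝ] (Fin 2 → Fin 2 → ℂ) :=
    { toFun := fun H i j => H j i, map_add' := fun _ _ => rfl, map_smul' := fun _ _ => rfl }
  have : (volume : Measure (Fin 2 → ℂ)).IsAddHaarMeasure := inferInstance
  have : (volume : Measure (Fin 2 → Fin 2 → ℂ)).IsAddHaarMeasure :=
    Measure.pi.isAddHaarMeasure (fun _ : Fin 2 => (volume : Measure (Fin 2 → ℂ)))
  refine measurePreserving_of_linearMap volume _ ?_ T T ?_ ?_
  · refine Measurable.ennreal_ofReal (Continuous.measurable ?_)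
    simp only [Matrix.trace, Matrix.diag, Matrix.mul_apply, Matrix.conjTranspose_apply,
      Matrix.of_apply, Fin.sum_univ_two]
    fun_prop
  · ext; rfl
  · intro H
    congr 5
    simp [T, Matrix.trace, Matrix.mul_apply, Fin.sum_univ_two]
    ring

/-! ### Hermitian forms and their Gaussian moments -/

/-- The Hermitian form `v ↦ v* M v`. -/
def hermForm (M : Matrix (Fin 2) (Fin 2) ℂ) (v : Fin 2 → ℂ) : ℂ := star v ⬝ᵥ (M *ᵥ v)

/-- The complete homogeneous symmetric polynomial of degree `k` in two variables. -/
def completeHomogeneous (a b : ℂ) (k : ℕ) : ℂ :=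
  ∑ ij ∈ Finset.HasAntidiagonal.antidiagonal k, a ^ ij.1 * b ^ ij.2

theorem hermForm_apply (M : Matrix (Fin 2) (Fin 2) ℂ) (v : Fin 2 → ℂ) :
    hermForm M v = star (v 0) * (M 0 0 * v 0 + M 0 1 * v 1) +
      star (v 1) * (M 1 0 * v 0 + M 1 1 * v 1) := by
  simp [hermForm, dotProduct, Matrix.mulVec, Fin.sum_univ_two]

theorem continuous_hermForm (M : Matrix (Fin 2) (Fin 2) ℂ) : Continuous (hermForm M) := by
  have : hermForm M = _ := funext (hermForm_apply M)
  rw [this]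
  fun_prop

theorem hermForm_conj (M B : Matrix (Fin 2) (Fin 2) ℂ) (v : Fin 2 → ℂ) :
    hermForm (Bᴴ * M * B) v = hermForm M (B *ᵥ v) := by
  simp only [hermForm, ← Matrix.mulVec_mulVec, Matrix.star_mulVec, ← Matrix.dotProduct_mulVec]

theorem hermForm_smul (M : Matrix (Fin 2) (Fin 2) ℂ) (r : ℝ) (v : Fin 2 → ℂ) :
    hermForm M ((r : ℂ) • v) = (r : ℂ) ^ 2 * hermForm M v := by
  simp [hermForm_apply]
  ring

theorem hermForm_one (v : Fin 2 → ℂ) :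
    hermForm 1 v = Complex.normSq (v 0) + Complex.normSq (v 1) := by
  simp [hermForm_apply, Complex.normSq_eq_conj_mul_self]

theorem HasAllMoments.hermForm {Ω : Type*} [MeasurableSpace Ω] {μ : Measure Ω} [IsFiniteMeasure μ]
    {f : Ω → Fin 2 → ℂ} {M : Ω → Matrix (Fin 2) (Fin 2) ℂ}
    (hf : ∀ i, HasAllMoments (fun x => f x i) μ) (hM : ∀ i j, HasAllMoments (fun x => M x i j) μ) :
    HasAllMoments (fun x => hermForm (M x) (f x)) μ := by
  simp only [hermForm_apply]
  exact ((hf 0).star.mul (((hM 0 0).mul (hf 0)).add ((hM 0 1).mul (hf 1)))).add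
    ((hf 1).star.mul (((hM 1 0).mul (hf 0)).add ((hM 1 1).mul (hf 1))))

theorem hasAllMoments_gaussianVectorMeasure (i : Fin 2) :
    HasAllMoments (fun v => v i) gaussianVectorMeasure :=
  hasAllMoments_stdComplexGaussian.comp (measurePreserving_eval _ i)

theorem hasAllMoments_gaussianMatrixMeasure (i j : Fin 2) :
    HasAllMoments (fun H => H i j) (gaussianMatrixMeasure 2) := by
  rw [gaussianMatrixMeasure_two]
  exact (hasAllMoments_gaussianVectorMeasure j).comp (measurePreserving_eval _ i)

theorem MeasureTheory.MeasurePreserving.integral_comp_of_continuous {α β : Type*}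
    [MeasurableSpace α] [MeasurableSpace β] [TopologicalSpace β] [OpensMeasurableSpace β]
    {μ : Measure α} {ν : Measure β} {T : α → β}
    (hT : MeasurePreserving T μ ν) {f : β → ℂ} (hf : Continuous f) :
    ∫ x, f (T x) ∂μ = ∫ y, f y ∂ν := by
  rw [← hT.map_eq, integral_map hT.measurable.aemeasurable hf.measurable.aestronglyMeasurable]

theorem integral_normSq_pow_mul_normSq_pow (i j : ℕ) :
    ∫ v, (Complex.normSq (v 0) : ℂ) ^ i * (Complex.normSq (v 1) : ℂ) ^ j ∂gaussianVectorMeasure =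
      i ! * j ! := by
  have h : ∀ k : ℕ, ∫ z, (Complex.normSq z : ℂ) ^ k ∂stdComplexGaussian = (k ! : ℂ) := by
    intro k
    have := congrArg (fun x : ℝ => (x : ℂ)) (integral_normSq_pow_stdComplexGaussian k)
    simp only [← integral_complex_ofReal] at this
    exact_mod_cast this
  have := integral_fintype_prod_eq_prod (μ := fun _ : Fin 2 => stdComplexGaussian)
    (fun (l : Fin 2) (z : ℂ) => (Complex.normSq z : ℂ) ^ (![i, j] l))
  simpa [Fin.prod_univ_two, h] using this

theorem integrable_normSq_pow_mul_normSq_pow (i j : ℕ) :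
    Integrable (fun v => (Complex.normSq (v 0) : ℂ) ^ i * (Complex.normSq (v 1) : ℂ) ^ j)
      gaussianVectorMeasure := by
  simp only [Complex.normSq_eq_conj_mul_self]
  have h := hasAllMoments_gaussianVectorMeasure
  exact ((((h 0).star.mul (h 0)).pow i).mul (((h 1).star.mul (h 1)).pow j)).integrable

/-- In the binomial expansion the moments `i! j!` cancel the denominators of the binomial
coefficients. -/
theorem integral_normSq_combination_pow (a b : ℂ) (k : ℕ) :
    ∫ v, (a * Complex.normSq (v 0) + b * Complex.normSq (v 1)) ^ k ∂gaussianVectorMeasure =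
      k ! * completeHomogeneous a b k := by
  have h : ∀ v : Fin 2 → ℂ, (a * Complex.normSq (v 0) + b * Complex.normSq (v 1)) ^ k =
      ∑ ij ∈ Finset.HasAntidiagonal.antidiagonal k, (k.choose ij.1 * (a ^ ij.1 * b ^ ij.2)) *
        ((Complex.normSq (v 0) : ℂ) ^ ij.1 * (Complex.normSq (v 1) : ℂ) ^ ij.2) := by
    intro v
    rw [(Commute.all _ _).add_pow']
    refine Finset.sum_congr rfl fun ij _ => ?_
    rw [nsmul_eq_mul]
    ring
  simp_rw [h]
  rw [integral_finsetSum _ fun ij _ => (integrable_normSq_pow_mul_normSq_pow _ _).const_mul _,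
    completeHomogeneous, Finset.mul_sum]
  refine Finset.sum_congr rfl fun ij hij => ?_
  rw [integral_const_mul, integral_normSq_pow_mul_normSq_pow]
  obtain rfl := Finset.HasAntidiagonal.mem_antidiagonal.1 hij
  rw [← Nat.add_choose_mul_factorial_mul_factorial ij.1 ij.2]
  push_cast
  rw [Nat.choose_symm_add]
  ring

/-- The extra factor raises one exponent at a time, so `i! j!` becomes `((i + 1) + (j + 1)) i! j!`,
and `i + j = k`. -/
theorem integral_normSq_mul_normSq_combination_pow (a b : ℂ) (k : ℕ) :
    ∫ v, ((Complex.normSq (v 0) : ℂ) + Complex.normSq (v 1)) *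
      (a * Complex.normSq (v 0) + b * Complex.normSq (v 1)) ^ k ∂gaussianVectorMeasure =
      (k + 2) * k ! * completeHomogeneous a b k := by
  have h : ∀ v : Fin 2 → ℂ, ((Complex.normSq (v 0) : ℂ) + Complex.normSq (v 1)) *
      (a * Complex.normSq (v 0) + b * Complex.normSq (v 1)) ^ k =
      ∑ ij ∈ Finset.HasAntidiagonal.antidiagonal k, (k.choose ij.1 * (a ^ ij.1 * b ^ ij.2)) *
        ((Complex.normSq (v 0) : ℂ) ^ (ij.1 + 1) * (Complex.normSq (v 1) : ℂ) ^ ij.2 +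
          (Complex.normSq (v 0) : ℂ) ^ ij.1 * (Complex.normSq (v 1) : ℂ) ^ (ij.2 + 1)) := by
    intro v
    rw [(Commute.all _ _).add_pow', Finset.mul_sum]
    refine Finset.sum_congr rfl fun ij _ => ?_
    rw [nsmul_eq_mul]
    ring
  simp_rw [h]
  rw [integral_finsetSum _ fun ij _ => Integrable.const_mul
    (Integrable.fun_add (integrable_normSq_pow_mul_normSq_pow _ _)
      (integrable_normSq_pow_mul_normSq_pow _ _)) _, completeHomogeneous, Finset.mul_sum]
  refine Finset.sum_congr rfl fun ij hij => ?_
  rw [integral_const_mul, integral_add (integrable_normSq_pow_mul_normSq_pow _ _)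
    (integrable_normSq_pow_mul_normSq_pow _ _), integral_normSq_pow_mul_normSq_pow,
    integral_normSq_pow_mul_normSq_pow]
  obtain rfl := Finset.HasAntidiagonal.mem_antidiagonal.1 hij
  rw [← Nat.add_choose_mul_factorial_mul_factorial ij.1 ij.2]
  push_cast [Nat.factorial_succ]
  rw [Nat.choose_symm_add]
  ring

theorem Matrix.IsHermitian.exists_unitary_hermForm {M : Matrix (Fin 2) (Fin 2) ℂ}
    (hM : M.IsHermitian) :
    ∃ U : Matrix (Fin 2) (Fin 2) ℂ, Uᴴ * U = 1 ∧ ∀ v, hermForm M (U *ᵥ v) =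
      hM.eigenvalues 0 * Complex.normSq (v 0) + hM.eigenvalues 1 * Complex.normSq (v 1) := by
  refine ⟨hM.eigenvectorUnitary, Unitary.coe_star_mul_self hM.eigenvectorUnitary, fun v => ?_⟩
  have h := hM.conjStarAlgAut_star_eigenvectorUnitary
  rw [Unitary.conjStarAlgAut_star_apply] at h
  rw [← hermForm_conj, ← Matrix.star_eq_conjTranspose, h, hermForm_apply]
  simp [Complex.normSq_eq_conj_mul_self]
  ring

theorem Matrix.IsHermitian.integral_hermForm_pow {M : Matrix (Fin 2) (Fin 2) ℂ}
    (hM : M.IsHermitian) (k : ℕ) :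
    ∫ v, hermForm M v ^ k ∂gaussianVectorMeasure =
      k ! * completeHomogeneous (hM.eigenvalues 0) (hM.eigenvalues 1) k := by
  obtain ⟨U, hU, h⟩ := hM.exists_unitary_hermForm
  rw [← (measurePreserving_unitary U hU).integral_comp_of_continuous
    (f := fun v => hermForm M v ^ k) ((continuous_hermForm M).pow k), ← integral_normSq_combination_pow]
  simp_rw [h]

theorem Matrix.IsHermitian.integral_hermForm_one_mul_hermForm_pow {M : Matrix (Fin 2) (Fin 2) ℂ}
    (hM : M.IsHermitian) (k : ℕ) :
    ∫ v, hermForm 1 v * hermForm M v ^ k ∂gaussianVectorMeasure =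
      (k + 2) * k ! * completeHomogeneous (hM.eigenvalues 0) (hM.eigenvalues 1) k := by
  obtain ⟨U, hU, h⟩ := hM.exists_unitary_hermForm
  rw [← (measurePreserving_unitary U hU).integral_comp_of_continuous
    (f := fun v => hermForm 1 v * hermForm M v ^ k) ((continuous_hermForm 1).mul ((continuous_hermForm M).pow k)),
    ← integral_normSq_mul_normSq_combination_pow]
  have h1 : ∀ v, hermForm 1 (U *ᵥ v) = hermForm 1 v := by
    intro v
    rw [← hermForm_conj, mul_one, hU]
  simp_rw [h, h1, hermForm_one]

theorem Matrix.IsHermitian.trace_pow {M : Matrix (Fin 2) (Fin 2) ℂ}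
    (hM : M.IsHermitian) (k : ℕ) :
    (M ^ k).trace = (hM.eigenvalues 0 : ℂ) ^ k + (hM.eigenvalues 1 : ℂ) ^ k := by
  conv_lhs => rw [hM.spectral_theorem]
  rw [← map_pow, Unitary.conjStarAlgAut_apply, Matrix.trace_mul_comm, ← mul_assoc,
    Unitary.coe_star_mul_self, one_mul, Matrix.diagonal_pow, Matrix.trace_diagonal,
    Fin.sum_univ_two]
  rfl

theorem Matrix.IsHermitian.trace_pow_add_two {M : Matrix (Fin 2) (Fin 2) ℂ}
    (hM : M.IsHermitian) (k : ℕ) :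
    (M ^ (k + 2)).trace =
      completeHomogeneous (hM.eigenvalues 0) (hM.eigenvalues 1) (k + 2) -
        M.det * completeHomogeneous (hM.eigenvalues 0) (hM.eigenvalues 1) k := by
  -- The two end terms of `h_{k+2}` are the pure powers; every inner term contains the product of
  -- the eigenvalues and belongs to `det M · h_k`.
  rw [hM.trace_pow, hM.det_eq_prod_eigenvalues, Fin.prod_univ_two, completeHomogeneous,
    completeHomogeneous, Finset.Nat.antidiagonal_succ_succ', Finset.sum_cons, Finset.sum_cons,
    Finset.sum_map, Finset.mul_sum]
  have : ∀ ij ∈ Finset.HasAntidiagonal.antidiagonal k, ((hM.eigenvalues 0 : ℝ) : ℂ) * (hM.eigenvalues 1 : ℝ) *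
      (((hM.eigenvalues 0 : ℝ) : ℂ) ^ ij.1 * ((hM.eigenvalues 1 : ℝ) : ℂ) ^ ij.2) =
      ((hM.eigenvalues 0 : ℝ) : ℂ) ^ (ij.1 + 1) * ((hM.eigenvalues 1 : ℝ) : ℂ) ^ (ij.2 + 1) :=
    fun _ _ => by ring
  simp only [Complex.coe_algebraMap] at *
  rw [Finset.sum_congr rfl this]
  simp
  ring

/-! ### Averaging over matrices with an invariant weight -/

theorem exists_unitary_col_eq (v : Fin 2 → ℂ) :
    ∃ (U : Matrix (Fin 2) (Fin 2) ℂ) (r : ℝ), Uᴴ * U = 1 ∧ (r : ℂ) ^ 2 = hermForm 1 v ∧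
      ∀ i, v i = r * U i 0 := by
  set s : ℝ := Complex.normSq (v 0) + Complex.normSq (v 1) with hs
  have hs0 : 0 ≤ s := add_nonneg (Complex.normSq_nonneg _) (Complex.normSq_nonneg _)
  have hsq : ((Real.sqrt s : ℝ) : ℂ) ^ 2 = hermForm 1 v := by
    rw [hermForm_one, ← Complex.ofReal_pow, Real.sq_sqrt hs0, hs, Complex.ofReal_add]
  by_cases h0 : s = 0
  · have h := (add_eq_zero_iff_of_nonneg (Complex.normSq_nonneg _) (Complex.normSq_nonneg _)).1 h0
    refine ⟨1, Real.sqrt s, by simp, hsq, ?_⟩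
    rw [Fin.forall_fin_two, h0]
    simpa using h
  · have hr : ((Real.sqrt s : ℝ) : ℂ) ≠ 0 := by
      exact_mod_cast (Real.sqrt_pos.2 (lt_of_le_of_ne hs0 (Ne.symm h0))).ne'
    have hsq' := hsq
    rw [hermForm_one, Complex.normSq_eq_conj_mul_self, Complex.normSq_eq_conj_mul_self] at hsq'
    set r := Real.sqrt s
    -- The unit vector `v / r` is completed by an orthogonal unit vector.
    refine ⟨!![v 0 / r, -star (v 1) / r; v 1 / r, star (v 0) / r], r, ?_, hsq, ?_⟩
    · ext i j
      fin_cases i <;> fin_cases j <;>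
        simp [Matrix.mul_apply, Fin.sum_univ_two] <;> field_simp
      · rw [hsq']
      · ring
      · ring
      · rw [hsq']
        ring
    · rw [Fin.forall_fin_two]
      constructor <;> simp <;> field_simp

/-- This is `H ↦ H U`: right multiplication acts on each row, viewed as a column vector, by `Uᵀ`. -/
theorem measurePreserving_mul_unitary (U : Matrix (Fin 2) (Fin 2) ℂ) (hU : Uᴴ * U = 1) :
    MeasurePreserving (fun (H : Fin 2 → Fin 2 → ℂ) i => Uᵀ *ᵥ H i) (gaussianMatrixMeasure 2)
      (gaussianMatrixMeasure 2) := by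
  rw [gaussianMatrixMeasure_two]
  refine measurePreserving_pi _ _ fun _ => measurePreserving_unitary Uᵀ ?_
  rw [show Uᵀᴴ = Uᴴᵀ from rfl, ← Matrix.transpose_mul, mul_eq_one_comm.1 hU,
    Matrix.transpose_one]

/-- With `v = r U e₀`, the vector `H v` is `r` times the first column of `H U`, and `H U` has the
law of `H`. -/
theorem integral_hermForm_mulVec_pow (A : Matrix (Fin 2) (Fin 2) ℂ)
    {w : (Fin 2 → Fin 2 → ℂ) → ℂ} (hw : Continuous w)
    (hwU : ∀ U : Matrix (Fin 2) (Fin 2) ℂ, Uᴴ * U = 1 → ∀ H, w (fun i => Uᵀ *ᵥ H i) = w H)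
    (k : ℕ) (v : Fin 2 → ℂ) :
    ∫ H, w H * hermForm A (Matrix.of H *ᵥ v) ^ k ∂gaussianMatrixMeasure 2 =
      hermForm 1 v ^ k * ∫ H, w H * hermForm A (fun i => H i 0) ^ k ∂gaussianMatrixMeasure 2 := by
  obtain ⟨U, r, hU, hr, hv⟩ := exists_unitary_col_eq v
  have hc : Continuous fun H : Fin 2 → Fin 2 → ℂ => w H * hermForm A (fun i => H i 0) ^ k :=
    hw.mul (((continuous_hermForm A).comp (by fun_prop)).pow k)
  rw [← (measurePreserving_mul_unitary U hU).integral_comp_of_continuous hc, ← integral_const_mul]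
  refine integral_congr_ae (.of_forall fun H => ?_)
  have : Matrix.of H *ᵥ v = (r : ℂ) • fun i => (Uᵀ *ᵥ H i) 0 := by
    ext i
    simp [Matrix.mulVec, dotProduct, Fin.sum_univ_two, hv]
    ring
  simp only [hwU U hU, this, hermForm_smul, hr]
  ring

theorem completeHomogeneous_one_one (k : ℕ) : completeHomogeneous 1 1 k = k + 1 := by
  simp [completeHomogeneous]

theorem integral_hermForm_one_pow (k : ℕ) :
    ∫ v, hermForm 1 v ^ k ∂gaussianVectorMeasure = (k + 1)! := by
  have := integral_normSq_combination_pow 1 1 k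
  simp only [one_mul, completeHomogeneous_one_one] at this
  simp only [hermForm_one, this, Nat.factorial_succ]
  push_cast
  ring

theorem HasAllMoments.conjTranspose_mul_mul {Ω : Type*} [MeasurableSpace Ω] {μ : Measure Ω}
    [IsFiniteMeasure μ] (A : Matrix (Fin 2) (Fin 2) ℂ) {H : Ω → Fin 2 → Fin 2 → ℂ}
    (hH : ∀ i j, HasAllMoments (fun x => H x i j) μ) (i j : Fin 2) :
    HasAllMoments (fun x => ((Matrix.of (H x))ᴴ * A * Matrix.of (H x)) i j) μ := by
  simp only [Matrix.mul_apply, Fin.sum_univ_two, Matrix.conjTranspose_apply, Matrix.of_apply]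
  exact (((((hH 0 i).star.mul (.const _)).add ((hH 1 i).star.mul (.const _))).mul (hH 0 j)).add
    ((((hH 0 i).star.mul (.const _)).add ((hH 1 i).star.mul (.const _))).mul (hH 1 j)))

theorem HasAllMoments.trace_pow {Ω : Type*} [MeasurableSpace Ω] {μ : Measure Ω}
    [IsFiniteMeasure μ] {M : Ω → Matrix (Fin 2) (Fin 2) ℂ}
    (hM : ∀ i j, HasAllMoments (fun x => M x i j) μ) (k : ℕ) :
    HasAllMoments (fun x => (M x ^ k).trace) μ := by
  have h : ∀ i j, HasAllMoments (fun x => (M x ^ k) i j) μ := by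
    induction k with
    | zero => exact fun i j => by simpa using .const _
    | succ k ih =>
      intro i j
      simp only [pow_succ, Matrix.mul_apply, Fin.sum_univ_two]
      exact ((ih i 0).mul (hM 0 j)).add ((ih i 1).mul (hM 1 j))
  simp only [Matrix.trace_fin_two]
  exact (h 0 0).add (h 1 1)

/-- Averaging the complete homogeneous polynomial of the eigenvalues of `H* A H`, against a weight
invariant under `H ↦ H U` for unitary `U`. -/
theorem integral_mul_completeHomogeneous_eigenvalues {A : Matrix (Fin 2) (Fin 2) ℂ}
    (hM : ∀ H : Fin 2 → Fin 2 → ℂ, ((Matrix.of H)ᴴ * A * Matrix.of H).IsHermitian)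
    {w : (Fin 2 → Fin 2 → ℂ) → ℂ} (hw : Continuous w)
    (hwm : HasAllMoments w (gaussianMatrixMeasure 2))
    (hwU : ∀ U : Matrix (Fin 2) (Fin 2) ℂ, Uᴴ * U = 1 → ∀ H, w (fun i => Uᵀ *ᵥ H i) = w H)
    (k : ℕ) :
    Integrable (fun H => w H * completeHomogeneous ((hM H).eigenvalues 0) ((hM H).eigenvalues 1) k)
        (gaussianMatrixMeasure 2) ∧
      ∫ H, w H * completeHomogeneous ((hM H).eigenvalues 0) ((hM H).eigenvalues 1) k
          ∂gaussianMatrixMeasure 2 =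
        (k + 1) * ∫ H, w H * hermForm A (fun i => H i 0) ^ k ∂gaussianMatrixMeasure 2 := by
  have hk : (k ! : ℂ) ≠ 0 := by exact_mod_cast k.factorial_ne_zero
  have hint : Integrable (fun p : (Fin 2 → Fin 2 → ℂ) × (Fin 2 → ℂ) =>
      w p.1 * hermForm ((Matrix.of p.1)ᴴ * A * Matrix.of p.1) p.2 ^ k)
      ((gaussianMatrixMeasure 2).prod gaussianVectorMeasure) := by
    refine ((hwm.comp measurePreserving_fst).mul (.pow (.hermForm (fun i => ?_) ?_) k)).integrable
    · exact (hasAllMoments_gaussianVectorMeasure i).comp measurePreserving_snd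
    · exact .conjTranspose_mul_mul A fun i j =>
        (hasAllMoments_gaussianMatrixMeasure i j).comp measurePreserving_fst
  have heq : ∀ H, w H * completeHomogeneous ((hM H).eigenvalues 0) ((hM H).eigenvalues 1) k =
      (k ! : ℂ)⁻¹ * ∫ v, w H * hermForm ((Matrix.of H)ᴴ * A * Matrix.of H) v ^ k
        ∂gaussianVectorMeasure := by
    intro H
    rw [integral_const_mul, (hM H).integral_hermForm_pow]
    field_simp
  simp_rw [heq]
  -- Fubini supplies the integrability, hence also the measurability, of this function of the
  -- eigenvalues.
  refine ⟨hint.integral_prod_left.const_mul _, ?_⟩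
  rw [integral_const_mul, integral_integral_swap hint]
  simp_rw [hermForm_conj, integral_hermForm_mulVec_pow A hw hwU]
  rw [integral_mul_const, integral_hermForm_one_pow, Nat.factorial_succ]
  push_cast
  field_simp

theorem integral_hermForm_col_pow {A : Matrix (Fin 2) (Fin 2) ℂ} (hA : A.IsHermitian) (k : ℕ) :
    ∫ H, hermForm A (fun i => H i 0) ^ k ∂gaussianMatrixMeasure 2 =
      k ! * completeHomogeneous (hA.eigenvalues 0) (hA.eigenvalues 1) k := by
  have h : MeasurePreserving (fun H : Fin 2 → Fin 2 → ℂ => H 0) (gaussianMatrixMeasure 2)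
      gaussianVectorMeasure := by
    rw [gaussianMatrixMeasure_two]
    exact measurePreserving_eval _ 0
  rw [← hA.integral_hermForm_pow]
  exact (h.comp measurePreserving_transpose).integral_comp_of_continuous
    (f := fun v => hermForm A v ^ k) ((continuous_hermForm A).pow k)

/-! ### The determinant weight -/

/-- The squared absolute value of the determinant of the `2 × 2` matrix with entries `H`. -/
def detNormSq (H : Fin 2 → Fin 2 → ℂ) : ℂ :=
  star (H 0 0 * H 1 1 - H 0 1 * H 1 0) * (H 0 0 * H 1 1 - H 0 1 * H 1 0)

theorem continuous_detNormSq : Continuous detNormSq := by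
  unfold detNormSq
  fun_prop

theorem hasAllMoments_detNormSq : HasAllMoments detNormSq (gaussianMatrixMeasure 2) := by
  have h := hasAllMoments_gaussianMatrixMeasure
  have hd := ((h 0 0).mul (h 1 1)).sub ((h 0 1).mul (h 1 0))
  exact hd.star.mul hd

theorem detNormSq_mul_unitary (U : Matrix (Fin 2) (Fin 2) ℂ) (hU : Uᴴ * U = 1)
    (H : Fin 2 → Fin 2 → ℂ) : detNormSq (fun i => Uᵀ *ᵥ H i) = detNormSq H := by
  have h := congrArg Matrix.det hU
  rw [Matrix.det_mul, Matrix.det_conjTranspose, Matrix.det_one] at h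
  have hd : (Uᵀ *ᵥ H 0) 0 * (Uᵀ *ᵥ H 1) 1 - (Uᵀ *ᵥ H 0) 1 * (Uᵀ *ᵥ H 1) 0 =
      (H 0 0 * H 1 1 - H 0 1 * H 1 0) * U.det := by
    simp [Matrix.mulVec, dotProduct, Fin.sum_univ_two, Matrix.det_fin_two]
    ring
  rw [detNormSq, hd, star_mul', mul_mul_mul_comm, h, mul_one, detNormSq]

theorem det_conjTranspose_mul_mul (A : Matrix (Fin 2) (Fin 2) ℂ) (H : Fin 2 → Fin 2 → ℂ) :
    ((Matrix.of H)ᴴ * A * Matrix.of H).det = A.det * detNormSq H := by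
  rw [Matrix.det_mul, Matrix.det_mul, Matrix.det_conjTranspose, Matrix.det_fin_two (Matrix.of H),
    detNormSq]
  simp only [Matrix.of_apply]
  ring

theorem integral_hermForm {M : Matrix (Fin 2) (Fin 2) ℂ} (hM : M.IsHermitian) :
    ∫ v, hermForm M v ∂gaussianVectorMeasure = M.trace := by
  have h := hM.integral_hermForm_pow 1
  have h' := hM.trace_pow 1
  simp only [pow_one] at h h'
  rw [h, h']
  simp [completeHomogeneous, Finset.Nat.antidiagonal_succ]
  ring

/-- For fixed `u` the determinant is linear in `v` with coefficients `(-u₁, u₀)`. Its squared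
modulus is thus a rank-one Hermitian form, whose mean is its trace. -/
theorem integral_detNormSq_cons (u : Fin 2 → ℂ) :
    ∫ v, detNormSq ![u, v] ∂gaussianVectorMeasure = hermForm 1 u := by
  have h : ∀ v, detNormSq ![u, v] =
      hermForm (Matrix.vecMulVec (star ![-u 1, u 0]) ![-u 1, u 0]) v := by
    intro v
    rw [hermForm_apply]
    simp [detNormSq, Matrix.vecMulVec_apply]
    ring
  simp_rw [h]
  rw [integral_hermForm]
  · simp [Matrix.trace_fin_two, hermForm_apply]
    ring
  · rw [Matrix.IsHermitian, Matrix.conjTranspose_vecMulVec, star_star]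

theorem integral_detNormSq_mul_hermForm_col_pow {A : Matrix (Fin 2) (Fin 2) ℂ}
    (hA : A.IsHermitian) (k : ℕ) :
    ∫ H, detNormSq H * hermForm A (fun i => H i 0) ^ k ∂gaussianMatrixMeasure 2 =
      (k + 2) * k ! * completeHomogeneous (hA.eigenvalues 0) (hA.eigenvalues 1) k := by
  have hc : Continuous fun H : Fin 2 → Fin 2 → ℂ => detNormSq H * hermForm A (H 0) ^ k :=
    continuous_detNormSq.mul (((continuous_hermForm A).comp (by fun_prop)).pow k)
  have hq : HasAllMoments (fun H : Fin 2 → Fin 2 → ℂ => hermForm A (H 0))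
      (gaussianMatrixMeasure 2) :=
    HasAllMoments.hermForm (fun i => hasAllMoments_gaussianMatrixMeasure 0 i)
      fun i j => HasAllMoments.const (A i j)
  have hm : HasAllMoments (fun H => detNormSq H * hermForm A (H 0) ^ k)
      (gaussianMatrixMeasure 2) := hasAllMoments_detNormSq.mul (hq.pow k)
  have ht : ∀ H : Fin 2 → Fin 2 → ℂ, detNormSq (fun i j => H j i) = detNormSq H := by
    intro H
    simp only [detNormSq, mul_comm (H 0 1)]
  have hp : MeasurePreserving (fun p : (Fin 2 → ℂ) × (Fin 2 → ℂ) => ![p.1, p.2])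
      (gaussianVectorMeasure.prod gaussianVectorMeasure) (gaussianMatrixMeasure 2) := by
    rw [gaussianMatrixMeasure_two]
    exact (measurePreserving_finTwoArrow gaussianVectorMeasure).symm
  -- Transposition puts the distinguished column in the first row, so that the second row can be
  -- integrated out independently.
  have h1 : ∫ H, detNormSq H * hermForm A (fun i => H i 0) ^ k ∂gaussianMatrixMeasure 2 =
      ∫ H, detNormSq H * hermForm A (H 0) ^ k ∂gaussianMatrixMeasure 2 := by
    rw [← measurePreserving_transpose.integral_comp_of_continuous hc]
    exact integral_congr_ae (.of_forall fun H =>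
      congrArg (· * hermForm A (fun i => H i 0) ^ k) (ht H).symm)
  rw [h1, ← hp.integral_comp_of_continuous hc, integral_prod _ (hm.comp hp).integrable,
    ← hA.integral_hermForm_one_mul_hermForm_pow]
  simp only [Matrix.cons_val_zero]
  simp_rw [integral_mul_const, integral_detNormSq_cons]

/-! ### The expected trace -/

theorem integral_trace_pow_add_two {A : Matrix (Fin 2) (Fin 2) ℂ} (hA : A.IsHermitian) (k : ℕ) :
    ∫ H, (((Matrix.of H)ᴴ * A * Matrix.of H) ^ (k + 2)).trace ∂gaussianMatrixMeasure 2 =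
      (k + 2)! * ((k + 3) * completeHomogeneous (hA.eigenvalues 0) (hA.eigenvalues 1) (k + 2) -
        A.det * completeHomogeneous (hA.eigenvalues 0) (hA.eigenvalues 1) k) := by
  have hM : ∀ H : Fin 2 → Fin 2 → ℂ, ((Matrix.of H)ᴴ * A * Matrix.of H).IsHermitian :=
    fun H => Matrix.isHermitian_conjTranspose_mul_mul _ hA
  obtain ⟨hi₁, h₁⟩ := integral_mul_completeHomogeneous_eigenvalues hM (w := fun _ => 1)
    continuous_const (.const 1) (fun _ _ _ => rfl) (k + 2)
  obtain ⟨hi₂, h₂⟩ := integral_mul_completeHomogeneous_eigenvalues hM continuous_detNormSq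
    hasAllMoments_detNormSq detNormSq_mul_unitary k
  simp only [one_mul] at hi₁ h₁
  have h : ∀ H : Fin 2 → Fin 2 → ℂ, (((Matrix.of H)ᴴ * A * Matrix.of H) ^ (k + 2)).trace =
      completeHomogeneous ((hM H).eigenvalues 0) ((hM H).eigenvalues 1) (k + 2) - A.det *
        (detNormSq H * completeHomogeneous ((hM H).eigenvalues 0) ((hM H).eigenvalues 1) k) := by
    intro H
    rw [(hM H).trace_pow_add_two, det_conjTranspose_mul_mul]
    ring
  simp_rw [h]
  rw [integral_sub hi₁ (hi₂.const_mul _), integral_const_mul, h₁, h₂, integral_hermForm_col_pow hA,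
    integral_detNormSq_mul_hermForm_col_pow hA, Nat.factorial_succ, Nat.factorial_succ]
  push_cast
  ring

/-- The exponent `1` lies below the range of the trace identity; there the trace is `h_1` itself,
with no determinant term. -/
theorem integral_trace {A : Matrix (Fin 2) (Fin 2) ℂ} (hA : A.IsHermitian) :
    ∫ H, ((Matrix.of H)ᴴ * A * Matrix.of H).trace ∂gaussianMatrixMeasure 2 =
      2 * completeHomogeneous (hA.eigenvalues 0) (hA.eigenvalues 1) 1 := by
  have hM : ∀ H : Fin 2 → Fin 2 → ℂ, ((Matrix.of H)ᴴ * A * Matrix.of H).IsHermitian :=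
    fun H => Matrix.isHermitian_conjTranspose_mul_mul _ hA
  have h₁ := (integral_mul_completeHomogeneous_eigenvalues hM (w := fun _ => 1)
    continuous_const (.const 1) (fun _ _ _ => rfl) 1).2
  simp only [one_mul, integral_hermForm_col_pow hA] at h₁
  have h : ∀ H : Fin 2 → Fin 2 → ℂ, ((Matrix.of H)ᴴ * A * Matrix.of H).trace =
      completeHomogeneous ((hM H).eigenvalues 0) ((hM H).eigenvalues 1) 1 := by
    intro H
    rw [(hM H).trace_eq_sum_eigenvalues]
    simp [completeHomogeneous, Finset.Nat.antidiagonal_succ, add_comm]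
  simp_rw [h]
  rw [h₁]
  norm_num

/-! ### Closed forms in the eigenvalues -/

theorem completeHomogeneous_comm (a b : ℂ) (k : ℕ) :
    completeHomogeneous a b k = completeHomogeneous b a k := by
  rw [completeHomogeneous, ← Finset.Nat.sum_antidiagonal_swap, completeHomogeneous]
  exact Finset.sum_congr rfl fun _ _ => mul_comm _ _

theorem completeHomogeneous_mul_sub (a b : ℂ) (k : ℕ) :
    completeHomogeneous a b k * (a - b) = a ^ (k + 1) - b ^ (k + 1) := by
  rw [← (Commute.all a b).geom_sum₂_mul, completeHomogeneous, Finset.Nat.sum_antidiagonal_eq_sum_range_succ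
    fun i j => a ^ i * b ^ j]
  rfl

theorem completeHomogeneous_self (a : ℂ) (k : ℕ) :
    completeHomogeneous a a k = (k + 1) * a ^ k := by
  have : ∀ ij ∈ Finset.HasAntidiagonal.antidiagonal k, a ^ ij.1 * a ^ ij.2 = a ^ k := by
    intro ij hij
    rw [← pow_add, Finset.HasAntidiagonal.mem_antidiagonal.1 hij]
  rw [completeHomogeneous, Finset.sum_congr rfl this]
  simp

/-- The roots determine the eigenvalues only up to order, which is harmless because the polynomial
is symmetric. -/
theorem Matrix.IsHermitian.completeHomogeneous_eigenvalues {A : Matrix (Fin 2) (Fin 2) ℂ}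
    (hA : A.IsHermitian) {a b : ℂ} (h : A.charpoly.roots = {a, b}) (k : ℕ) :
    completeHomogeneous (hA.eigenvalues 0) (hA.eigenvalues 1) k = completeHomogeneous a b k := by
  rw [hA.roots_charpoly_eq_eigenvalues] at h
  have h' : ({(hA.eigenvalues 0 : ℂ), (hA.eigenvalues 1 : ℂ)} : Multiset ℂ) = {a, b} := by
    rw [← h]
    rfl
  rcases Multiset.cons_eq_cons.1 h' with ⟨h0, h1⟩ | ⟨-, s, h0, h1⟩
  · rw [h0, Multiset.singleton_inj.1 h1]
  · have hs : s = 0 := by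
      rw [← Multiset.card_eq_zero]
      simpa using (congrArg Multiset.card h0).symm
    subst hs
    rw [Multiset.singleton_inj.1 h0, ← Multiset.singleton_inj.1 h1, completeHomogeneous_comm]

theorem mainTheorem5 (A : Matrix (Fin 2) (Fin 2) ℂ) (hA : A.IsHermitian) (d₁ d₂ : ℝ)
    (hd : A.charpoly.roots = {(d₁ : ℂ), (d₂ : ℂ)}) (m : ℕ) (hm : 1 ≤ m) :
    Integrable (fun H : Fin 2 → Fin 2 → ℂ =>
        (((Matrix.of H)ᴴ * A * Matrix.of H) ^ m).trace) (gaussianMatrixMeasure 2) ∧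
      (d₁ ≠ d₂ →
        ∫ H, (((Matrix.of H)ᴴ * A * Matrix.of H) ^ m).trace ∂(gaussianMatrixMeasure 2) =
          (((m ! : ℝ) * (((m : ℝ) + 1) * ((d₁ ^ (m + 1) - d₂ ^ (m + 1)) / (d₁ - d₂)) +
            (d₁ * d₂ ^ m - d₂ * d₁ ^ m) / (d₁ - d₂)) : ℝ) : ℂ)) ∧
      (∀ d : ℝ, d₁ = d → d₂ = d →
        ∫ H, (((Matrix.of H)ᴴ * A * Matrix.of H) ^ m).trace ∂(gaussianMatrixMeasure 2) =
          (((m ! : ℝ) * ((m : ℝ) ^ 2 + (m : ℝ) + 2) * d ^ m : ℝ) : ℂ)) := by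
  have hint : Integrable (fun H : Fin 2 → Fin 2 → ℂ =>
      (((Matrix.of H)ᴴ * A * Matrix.of H) ^ m).trace) (gaussianMatrixMeasure 2) :=
    (HasAllMoments.trace_pow (HasAllMoments.conjTranspose_mul_mul A
      hasAllMoments_gaussianMatrixMeasure) m).integrable
  have hdet : A.det = d₁ * d₂ := by
    rw [Matrix.det_eq_prod_roots_charpoly_of_splits hA.splits_charpoly, hd]
    simp
  refine ⟨hint, fun hne => ?_, ?_⟩
  · have hne' : (d₁ : ℂ) - d₂ ≠ 0 := sub_ne_zero.2 (by exact_mod_cast hne)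
    have hh : ∀ k, completeHomogeneous (hA.eigenvalues 0) (hA.eigenvalues 1) k =
        ((d₁ : ℂ) ^ (k + 1) - d₂ ^ (k + 1)) / (d₁ - d₂) := by
      intro k
      rw [hA.completeHomogeneous_eigenvalues hd, eq_div_iff hne', completeHomogeneous_mul_sub]
    obtain _ | _ | k := m
    · omega
    · simp only [zero_add, pow_one, integral_trace hA, hh]
      push_cast
      field_simp
      norm_num
      ring
    · rw [integral_trace_pow_add_two hA, hh, hh, hdet]
      push_cast
      field_simp
      ring
  · rintro d rfl rfl
    have hh : ∀ k, completeHomogeneous (hA.eigenvalues 0) (hA.eigenvalues 1) k =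
        (k + 1) * (d₂ : ℂ) ^ k := by
      intro k
      rw [hA.completeHomogeneous_eigenvalues hd, completeHomogeneous_self]
    obtain _ | _ | k := m
    · omega
    · simp only [zero_add, pow_one, integral_trace hA, hh]
      push_cast
      norm_num
      ring
    · rw [integral_trace_pow_add_two hA, hh, hh, hdet]
      push_cast
      ring
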